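/- Let $b\ge 1$ and write $[n]=\{1,\dots,n\}$. A grid-labelled graph of type $(2,b)$ is a simple graph $G$ on $2b$ vertices together with a bijective labelling of its vertices by $[2]\times[b]$; vertices are identified with their labels $(i,j)$ ($i$ the row, $j$ the column). An edge $\{(i,j),(k,l)\}$ is called horizontal if $i=k$, and diagonal if $i\ne k$ and $j\neq l$. The partial transpose $\Gamma(G)$ is the grid-labelled graph whose edges are $\{(k,j),(i,l)\}$ for all edges $\{(i,j),(k,l)\}$ of $G$. Let $D(G)$ be the diagonal matrix of vertex degrees of $G$, $A(G)$ its adjacency matrix, and, when $G$ has $m\ge 1$ edges, let $\rho(G)=\frac{1}{2m}\,(D(G)-A(G))$, a density matrix on $\mathbb{C}^2\otimes\mathbb{C}^b$. A density matrix is a positive semidefinite complex matrix of trace $1$; $G$ is called separable if $\rho(G)=\sum_i p_i\,\rho_i\otimes\sigma_i$ is a finite sum with $p_i\ge 0$, $\sum_i p_i=1$, and $\rho_i$, $\sigma_i$ density matrices of size $2\times 2$ and $b\times b$. Theorem. Let $G$ be a grid-labelled graph of type $(2,b)$ with at least one edge. (1) $G$ satisfies the degree criterion $D(G)=D(\Gamma(G))$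 if and only if $G$ is separable. (2) $G$ is separable if and only if $d((1,j))=d((2,j))$ for every $1\le j\le b$, where $d((i,j))$ denotes the number of diagonal edges of $G$ at the vertex $(i,j)$. (3) If $G$ has no horizontal edges, then $G$ is separable if and only if, for every $1\le j\le b$, the vertices $(1,j)$ and $(2,j)$ have the same degree in $G$. -/

import Mathlib

open scoped Kronecker ComplexOrder

/-- A grid-labelled graph `(G, l; a, b)` of type `(a, b)`: a simple graph `G` on a vertex set `V`
together with a bijective labelling `l` of `V` by the grid `[a] × [b]`
(here indexed from `0`: row `i + 1` of the grid is `i : Fin a`). -/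
structure GridLabelledGraph (V : Type*) (a b : ℕ) where
  graph : SimpleGraph V
  label : V ≃ Fin a × Fin b

namespace GridLabelledGraph

variable {V : Type*} {a b : ℕ}

/-- The same graph with its vertices named by their labels: `{l(u), l(v)}` is an edge iff
`{u, v}` is an edge. -/
def gridGraph (G : GridLabelledGraph V a b) : SimpleGraph (Fin a × Fin b) :=
  G.graph.comap G.label.symm

/-- The degree `d((i, j))` of the vertex labelled `(i, j)`. -/
noncomputable def degree (G : GridLabelledGraph V a b) (p : Fin a × Fin b) : ℕ := by
  classical exact G.gridGraph.degree p

/-- The degree matrix `D(G)`, indexed by labels. -/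
noncomputable def degreeMatrix (G : GridLabelledGraph V a b) :
    Matrix (Fin a × Fin b) (Fin a × Fin b) ℂ := by
  classical exact G.gridGraph.degMatrix ℂ

/-- The combinatorial Laplacian `L(G) = D(G) - A(G)`, indexed by labels. -/
noncomputable def laplacian (G : GridLabelledGraph V a b) :
    Matrix (Fin a × Fin b) (Fin a × Fin b) ℂ := by
  classical exact G.gridGraph.lapMatrix ℂ

/-- The number `m` of edges. -/
noncomputable def numEdges (G : GridLabelledGraph V a b) : ℕ := G.graph.edgeSet.ncard

/-- The density matrix `ρ(G) = L(G) / 2m` (meaningful when `G` has at least one edge). -/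
noncomputable def densityMatrix (G : GridLabelledGraph V a b) :
    Matrix (Fin a × Fin b) (Fin a × Fin b) ℂ :=
  (1 / (2 * (G.numEdges : ℂ))) • G.laplacian

/-- The partial transpose `Γ(G)`: every edge `{(i, j), (k, l)}` of `G` is replaced by the edge
`{(k, j), (i, l)}`. -/
def partialTranspose (G : GridLabelledGraph V a b) : GridLabelledGraph V a b where
  graph :=
    { Adj := fun u v => ∃ x y, G.graph.Adj x y ∧
        G.label u = ((G.label y).1, (G.label x).2) ∧
        G.label v = ((G.label x).1, (G.label y).2)
      symm := ⟨by
        rintro u v ⟨x, y, h, hu, hv⟩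
        exact ⟨y, x, h.symm, hv, hu⟩⟩
      loopless := ⟨by
        rintro u ⟨x, y, h, hu, hv⟩
        have e : ((G.label y).1, (G.label x).2) = ((G.label x).1, (G.label y).2) :=
          hu.symm.trans hv
        have e1 := congrArg Prod.fst e
        have e2 := congrArg Prod.snd e
        exact h.ne (G.label.injective (Prod.ext e1.symm e2))⟩ }
  label := G.label

/-- The subgraph formed by the diagonal edges, i.e. the edges `{(i, j), (k, l)}` with `i ≠ k` and
`j ≠ l`. -/
def diagonalPart (G : GridLabelledGraph V a b) : GridLabelledGraph V a b where
  graph :=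
    { Adj := fun u v => G.graph.Adj u v ∧
        (G.label u).1 ≠ (G.label v).1 ∧ (G.label u).2 ≠ (G.label v).2
      symm := ⟨fun _ _ h => ⟨h.1.symm, h.2.1.symm, h.2.2.symm⟩⟩
      loopless := ⟨fun _ h => h.1.ne rfl⟩ }
  label := G.label

/-- An edge `{(i, j), (k, l)}` is horizontal when `i = k`. -/
def HasHorizontalEdge (G : GridLabelledGraph V a b) : Prop :=
  ∃ u v, G.graph.Adj u v ∧ (G.label u).1 = (G.label v).1

/-- The degree criterion `D(G) = D(Γ(G))`. -/
def DegreeCriterion (G : GridLabelledGraph V a b) : Prop :=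
  G.degreeMatrix = G.partialTranspose.degreeMatrix

end GridLabelledGraph

/-- A density matrix: positive semidefinite (in particular Hermitian) of trace one. -/
def IsDensityMatrix {n : Type*} [Fintype n] (M : Matrix n n ℂ) : Prop :=
  M.PosSemidef ∧ M.trace = 1

/-- A matrix on `ℂ^a ⊗ ℂ^b` is separable when it is a finite convex combination of Kronecker
products of density matrices. -/
def IsSeparableMatrix {a b : ℕ} (M : Matrix (Fin a × Fin b) (Fin a × Fin b) ℂ) : Prop :=
  ∃ (n : ℕ) (p : Fin n → ℝ) (r : Fin n → Matrix (Fin a) (Fin a) ℂ)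
    (s : Fin n → Matrix (Fin b) (Fin b) ℂ),
    (∀ i, 0 ≤ p i) ∧ ∑ i, p i = 1 ∧
    (∀ i, IsDensityMatrix (r i)) ∧ (∀ i, IsDensityMatrix (s i)) ∧
    M = ∑ i, (p i : ℂ) • (r i ⊗ₖ s i)

/-- `G ∈ 𝒮`: the density matrix of `G` is separable. -/
def GridLabelledGraph.IsSeparable {V : Type*} {a b : ℕ} (G : GridLabelledGraph V a b) : Prop :=
  IsSeparableMatrix G.densityMatrix

/-! All the degree conditions reduce to one: for every column `j`, the vertex `(0, j)` has as many
neighbours in row 1 as `(1, j)` has in row 0. The point is that this is equivalent to separability.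

Necessity: a separable state has a positive semidefinite partial transpose `P`. Its entries sum to
those of the Laplacian, hence to zero, so `P` kills the all-ones vector. The row sums of `P` are the
differences of degrees in `G` and `Γ(G)`, up to scale.

Sufficiency (`laplacian_eq_sum_of_rowDegree_eq`): horizontal and vertical edges contribute visibly
separable terms. Diagonal edges contribute `[[D, -N], [-Nᵀ, D]]`, where the condition makes row and
column sums of `N` agree. Birkhoff's theorem reduces `N` to permutations
(`twoRowBlock_mem_separableCone`), and the discrete Fourier transform along the orbits of a
permutation writes its block as a sum of products of rank-one projections up to scale
(`twoRowBlock_action_mem_separableCone`). -/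

/-! ### The separable cone and normalisation -/

/-- The cone of unnormalised separable matrices: finite sums of Kronecker products of positive
semidefinite matrices. -/
def separableCone (m n : Type*) : AddSubmonoid (Matrix (m × n) (m × n) ℂ) :=
  AddSubmonoid.closure {M | ∃ (r : Matrix m m ℂ) (s : Matrix n n ℂ),
    r.PosSemidef ∧ s.PosSemidef ∧ M = r ⊗ₖ s}

lemma kronecker_mem_separableCone {m n : Type*} {r : Matrix m m ℂ} {s : Matrix n n ℂ}
    (hr : r.PosSemidef) (hs : s.PosSemidef) : r ⊗ₖ s ∈ separableCone m n :=
  AddSubmonoid.subset_closure ⟨r, s, hr, hs, rfl⟩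

lemma smul_mem_separableCone {m n : Type*} {M : Matrix (m × n) (m × n) ℂ}
    (hM : M ∈ separableCone m n) {c : ℝ} (hc : 0 ≤ c) : (c : ℂ) • M ∈ separableCone m n := by
  induction hM using AddSubmonoid.closure_induction with
  | mem M h =>
    obtain ⟨r, s, hr, hs, rfl⟩ := h
    rw [← Matrix.smul_kronecker]
    exact kronecker_mem_separableCone (hr.smul (Complex.zero_le_real.2 hc)) hs
  | zero => simp
  | add x y _ _ hx hy => rw [smul_add]; exact add_mem hx hy

lemma Matrix.PosSemidef.isDensityMatrix_inv_trace_smul {n : Type*} [Fintype n]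
    {r : Matrix n n ℂ} (hr : r.PosSemidef) (h : r.trace ≠ 0) :
    IsDensityMatrix (r.trace⁻¹ • r) := by
  refine ⟨hr.smul ?_, ?_⟩
  · exact inv_nonneg.2 hr.trace_nonneg
  · rw [Matrix.trace_smul, smul_eq_mul, inv_mul_cancel₀ h]

/-- Each factor is divided by its trace and the product of traces becomes the weight; a positive
semidefinite factor of trace zero vanishes, so its term is dropped. -/
lemma exists_densityMatrix_decomposition {a b : ℕ}
    {M : Matrix (Fin a × Fin b) (Fin a × Fin b) ℂ} (hM : M ∈ separableCone (Fin a) (Fin b)) :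
    ∃ (n : ℕ) (p : Fin n → ℝ) (r : Fin n → Matrix (Fin a) (Fin a) ℂ)
      (s : Fin n → Matrix (Fin b) (Fin b) ℂ),
      (∀ i, 0 ≤ p i) ∧ (∀ i, IsDensityMatrix (r i)) ∧ (∀ i, IsDensityMatrix (s i)) ∧
      M = ∑ i, (p i : ℂ) • (r i ⊗ₖ s i) := by
  induction hM using AddSubmonoid.closure_induction with
  | mem M h =>
    obtain ⟨r, s, hr, hs, rfl⟩ := h
    by_cases h0 : r.trace = 0
    · exact ⟨0, Fin.elim0, Fin.elim0, Fin.elim0, fun i => i.elim0, fun i => i.elim0,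
        fun i => i.elim0, by simp [hr.trace_eq_zero_iff.1 h0]⟩
    by_cases h1 : s.trace = 0
    · exact ⟨0, Fin.elim0, Fin.elim0, Fin.elim0, fun i => i.elim0, fun i => i.elim0,
        fun i => i.elim0, by simp [hs.trace_eq_zero_iff.1 h1]⟩
    obtain ⟨x, hx, hxr⟩ := RCLike.nonneg_iff_exists_ofReal.1 hr.trace_nonneg
    replace hxr : (x : ℂ) = r.trace := hxr
    obtain ⟨y, hy, hys⟩ := RCLike.nonneg_iff_exists_ofReal.1 hs.trace_nonneg
    replace hys : (y : ℂ) = s.trace := hys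
    refine ⟨1, fun _ => x * y, fun _ => r.trace⁻¹ • r, fun _ => s.trace⁻¹ • s,
      fun _ => mul_nonneg hx hy, fun _ => hr.isDensityMatrix_inv_trace_smul h0,
      fun _ => hs.isDensityMatrix_inv_trace_smul h1, ?_⟩
    rw [Fin.sum_univ_one, Matrix.smul_kronecker, Matrix.kronecker_smul, smul_smul, smul_smul]
    push_cast
    rw [hxr, hys, mul_right_comm r.trace, mul_inv_cancel₀ h0, one_mul, mul_inv_cancel₀ h1,
      one_smul]
  | zero =>
    exact ⟨0, Fin.elim0, Fin.elim0, Fin.elim0, fun i => i.elim0, fun i => i.elim0,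
      fun i => i.elim0, by simp⟩
  | add x y _ _ hx hy =>
    obtain ⟨n, p, r, s, hp, hr, hs, rfl⟩ := hx
    obtain ⟨n', p', r', s', hp', hr', hs', rfl⟩ := hy
    refine ⟨n + n', Fin.append p p', Fin.append r r', Fin.append s s', ?_, ?_, ?_, ?_⟩
    · exact fun i => Fin.addCases (fun i => by simpa using hp i) (fun i => by simpa using hp' i) i
    · exact fun i => Fin.addCases (fun i => by simpa using hr i) (fun i => by simpa using hr' i) i
    · exact fun i => Fin.addCases (fun i => by simpa using hs i) (fun i => by simpa using hs' i) i
    · simp [Fin.sum_univ_add]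

lemma isSeparableMatrix_of_mem_separableCone {a b : ℕ}
    {M : Matrix (Fin a × Fin b) (Fin a × Fin b) ℂ} (hM : M ∈ separableCone (Fin a) (Fin b))
    (htr : M.trace = 1) : IsSeparableMatrix M := by
  obtain ⟨n, p, r, s, hp, hr, hs, rfl⟩ := exists_densityMatrix_decomposition hM
  refine ⟨n, p, r, s, hp, ?_, hr, hs, rfl⟩
  -- Every product of density matrices has trace one, so the trace of the sum is the total weight.
  simp only [Matrix.trace_sum, Matrix.trace_smul, Matrix.trace_kronecker, (hr _).2, (hs _).2,
    mul_one, smul_eq_mul] at htr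
  exact_mod_cast htr

/-- Separable matrices have positive semidefinite partial transpose. -/
lemma IsSeparableMatrix.posSemidef_partialTranspose {a b : ℕ}
    {M : Matrix (Fin a × Fin b) (Fin a × Fin b) ℂ} (hM : IsSeparableMatrix M) :
    (Matrix.of fun p q : Fin a × Fin b => M (q.1, p.2) (p.1, q.2)).PosSemidef := by
  obtain ⟨n, p, r, s, hp, -, hr, hs, rfl⟩ := hM
  have : (Matrix.of fun x y : Fin a × Fin b =>
      (∑ i, (p i : ℂ) • (r i ⊗ₖ s i)) (y.1, x.2) (x.1, y.2)) =
      ∑ i, (p i : ℂ) • ((r i).transpose ⊗ₖ s i) := by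
    ext x y
    simp [Matrix.sum_apply]
  rw [this]
  exact Matrix.posSemidef_sum _ fun i _ =>
    ((hr i).1.transpose.kronecker (hs i).1).smul (Complex.zero_le_real.2 (hp i))

open scoped MatrixOrder Matrix.Norms.L2Operator in
lemma Matrix.PosSemidef.map_ofReal {n : Type*} [Fintype n] {A : Matrix n n ℝ}
    (hA : A.PosSemidef) : (A.map Complex.ofReal).PosSemidef := by
  classical
  obtain ⟨B, rfl⟩ := CStarAlgebra.nonneg_iff_eq_star_mul_self.mp hA.nonneg
  have : (star B * B).map Complex.ofReal =
      (B.map Complex.ofReal).conjTranspose * B.map Complex.ofReal := by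
    ext i j
    simp [Matrix.mul_apply, Matrix.star_apply]
  rw [this]
  exact Matrix.posSemidef_conjTranspose_mul_self _

/-! ### Separability of two-row block matrices -/

/-- The two-row block matrix `[[D, -N], [-Nᵀ, D]]` with `D = diag d`. -/
def twoRowBlock {n : Type*} [DecidableEq n] (d : n → ℝ) (N : Matrix n n ℝ) :
    Matrix (Fin 2 × n) (Fin 2 × n) ℂ :=
  Matrix.of fun p q => if p.1 = q.1 then (if p.2 = q.2 then (d p.2 : ℂ) else 0)
    else if p.1 = 0 then -(N p.2 q.2 : ℂ) else -(N q.2 p.2 : ℂ)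

lemma sum_stdAddChar_mul {k : ℕ} [NeZero k] (a : ZMod k) :
    ∑ t : ZMod k, ZMod.stdAddChar (t * a) = if a = 0 then (k : ℂ) else 0 := by
  classical
  rw [AddChar.sum_mulShift _ (ZMod.isPrimitive_stdAddChar k), ZMod.card]
  simp

lemma star_stdAddChar {k : ℕ} [NeZero k] (a : ZMod k) :
    star (ZMod.stdAddChar a : ℂ) = ZMod.stdAddChar (-a) := by
  rw [ZMod.stdAddChar_apply, ZMod.stdAddChar_apply, AddChar.map_neg_eq_inv,
    Circle.coe_inv_eq_conj]
  rfl

section Orbit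
variable {n : Type*} [Fintype n] [DecidableEq n] {k : ℕ} [NeZero k]

/-- The discrete Fourier vector at frequency `t` along the orbit of `j` under the action `g` of
`ZMod k`. -/
noncomputable def orbitFourier (g : ZMod k → Equiv.Perm n) (t : ZMod k) (j x : n) : ℂ :=
  ∑ s, if g s j = x then ZMod.stdAddChar (t * s) else 0

/-- For fixed `s'`, the condition `g s' j = y` determines `j`, and `r = s - s'` then satisfies `g r
y = x`. Each of the `k` values of `s'` gives the same sum, and `f j = f x` because `f` is constant
on orbits. -/
lemma sum_orbitFourier_mul_star (g : ZMod k → Equiv.Perm n)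
    (hg : ∀ s s', g (s + s') = g s * g s') (f : n → ℝ) (hf : ∀ s x, f (g s x) = f x)
    (t : ZMod k) (x y : n) :
    ∑ j, (f j : ℂ) * (orbitFourier g t j x * star (orbitFourier g t j y)) =
      k * ∑ r, if g r y = x then (f x : ℂ) * ZMod.stdAddChar (t * r) else 0 := by
  have key : ∀ s' : ZMod k, ∑ j, ∑ s, (if g s j = x ∧ g s' j = y then
        (f j : ℂ) * ZMod.stdAddChar (t * (s - s')) else 0) =
      ∑ r, if g r y = x then (f x : ℂ) * ZMod.stdAddChar (t * r) else 0 := by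
    intro s'
    rw [Finset.sum_eq_single ((g s').symm y)]
    · rw [← Equiv.sum_comp (Equiv.addRight s')]
      refine Finset.sum_congr rfl fun r _ => ?_
      have h1 : g (r + s') ((g s').symm y) = g r y := by simp [hg]
      have h2 : g r y = x → f ((g s').symm y) = f x := by
        rintro rfl
        rw [hf, ← hf s', Equiv.apply_symm_apply]
      simp only [Equiv.coe_addRight, h1, Equiv.apply_symm_apply, and_true, add_sub_cancel_right]
      split_ifs with h
      · rw [h2 h]
      · rfl
    · intro j _ hj
      refine Finset.sum_eq_zero fun s _ => if_neg ?_
      rintro ⟨-, rfl⟩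
      exact hj (by simp)
    · simp
  calc _ = ∑ j, ∑ s' : ZMod k, ∑ s, (if g s j = x ∧ g s' j = y then
        (f j : ℂ) * ZMod.stdAddChar (t * (s - s')) else 0) := by
        refine Finset.sum_congr rfl fun j _ => ?_
        rw [orbitFourier, orbitFourier, star_sum, Finset.sum_mul_sum, Finset.sum_comm,
          Finset.mul_sum]
        refine Finset.sum_congr rfl fun s' _ => ?_
        rw [Finset.mul_sum]
        refine Finset.sum_congr rfl fun s _ => ?_
        by_cases h : g s j = x <;> by_cases h' : g s' j = y <;> simp only [h, h', if_true, if_false,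
          zero_mul, mul_zero, star_zero, and_self, and_true, and_false]
        rw [star_stdAddChar, ← AddChar.map_add_eq_mul]
        congr 2
        ring
    _ = _ := by
        rw [Finset.sum_comm, Finset.sum_congr rfl fun s' _ => key s']
        simp [Finset.card_univ, ZMod.card]

/-- Fourier inversion on `ZMod k`: a character `t * c` in the row factor selects the group element
`-c` in the column factor. The diagonal blocks have `c = 0`, the off-diagonal ones `c = 1` and `c =
-1`. -/
lemma twoRowBlock_action_mem_separableCone (g : ZMod k → Equiv.Perm n)
    (hg : ∀ s s', g (s + s') = g s * g s') (f : n → ℝ) (hf0 : ∀ x, 0 ≤ f x)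
    (hf : ∀ s x, f (g s x) = f x) :
    twoRowBlock f (Matrix.of fun x y => if g 1 x = y then f x else 0) ∈
      separableCone (Fin 2) n := by
  have hg0 : g 0 = 1 := by simpa using hg 0 0
  have hgneg : ∀ s x y, g s x = y ↔ g (-s) y = x := by
    intro s x y
    have h1 : g s * g (-s) = 1 := by rw [← hg, add_neg_cancel, hg0]
    rw [← inv_eq_of_mul_eq_one_right h1]
    rw [Equiv.Perm.inv_eq_iff_eq, eq_comm]
  have hk : (k : ℂ) ≠ 0 := Nat.cast_ne_zero.2 (NeZero.ne k)
  have hsum : ∀ (c x y), ∑ t : ZMod k, ZMod.stdAddChar (t * c) *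
      ∑ j, (f j : ℂ) * (orbitFourier g t j x * star (orbitFourier g t j y)) =
      (k : ℂ) * k * if g (-c) y = x then (f x : ℂ) else 0 := by
    intro c x y
    simp only [sum_orbitFourier_mul_star g hg f hf]
    calc _ = (k : ℂ) * ∑ r, if g r y = x then
          (f x : ℂ) * ∑ t : ZMod k, ZMod.stdAddChar (t * (c + r)) else 0 := by
          simp only [Finset.mul_sum]
          rw [Finset.sum_comm]
          refine Finset.sum_congr rfl fun r _ => ?_
          split_ifs
          · rw [Finset.mul_sum]
            refine Finset.sum_congr rfl fun t _ => ?_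
            rw [mul_add, AddChar.map_add_eq_mul]
            ring
          · simp
      _ = _ := by
          simp only [sum_stdAddChar_mul]
          rw [Finset.sum_eq_single (-c)]
          · simp only [add_neg_cancel, if_true]
            split_ifs
            · ring
            · simp
          · intro r _ hr
            have : c + r ≠ 0 := fun h => hr (eq_neg_of_add_eq_zero_right h)
            simp [this]
          · simp
  -- Chosen so that `u t 0 * star (u t 1)` is minus the character at `t`, which yields the sign and
  -- the shift by one.
  let u : ZMod k → Fin 2 → ℂ := fun t => ![1, -ZMod.stdAddChar (-t)]
  have hdecomp : twoRowBlock f (Matrix.of fun x y => if g 1 x = y then f x else 0) =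
      (((k : ℝ) * k)⁻¹ : ℝ) • ∑ t : ZMod k, ∑ j, (f j : ℝ) •
        (Matrix.vecMulVec (u t) (star (u t)) ⊗ₖ
          Matrix.vecMulVec (orbitFourier g t j) (star (orbitFourier g t j))) := by
    have huu : ∀ t, ZMod.stdAddChar (N := k) (-t) * star (ZMod.stdAddChar (N := k) (-t)) = 1 := by
      intro t
      rw [star_stdAddChar, ← AddChar.map_add_eq_mul]; simp
    have hform : ∀ (i i' : Fin 2) (ε : ℂ) (c : ZMod k),
        (∀ t, u t i * star (u t i') = ε * ZMod.stdAddChar (t * c)) → ∀ x y,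
        ((((k : ℝ) * k)⁻¹ : ℝ) • ∑ t : ZMod k, ∑ j, (f j : ℝ) •
        (Matrix.vecMulVec (u t) (star (u t)) ⊗ₖ
          Matrix.vecMulVec (orbitFourier g t j) (star (orbitFourier g t j)))) (i, x) (i', y) =
        ε * if g (-c) y = x then (f x : ℂ) else 0 := by
      intro i i' ε c h x y
      have : ((k : ℂ) * k) * (ε * if g (-c) y = x then (f x : ℂ) else 0) =
          ∑ t : ZMod k, ∑ j, (f j : ℂ) * ((u t i * star (u t i')) *
            (orbitFourier g t j x * star (orbitFourier g t j y))) := by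
        rw [mul_left_comm, ← hsum c x y, Finset.mul_sum]
        refine Finset.sum_congr rfl fun t _ => ?_
        rw [h, ← mul_assoc, Finset.mul_sum]
        refine Finset.sum_congr rfl fun j _ => ?_
        ring
      rw [Matrix.smul_apply, Matrix.sum_apply, Complex.real_smul]
      simp only [Matrix.sum_apply, Matrix.smul_apply, Complex.real_smul, Matrix.kroneckerMap_apply,
        Matrix.vecMulVec_apply, Pi.star_apply]
      rw [← this]
      push_cast
      rw [inv_mul_cancel_left₀ (mul_ne_zero hk hk)]
    ext ⟨i, x⟩ ⟨i', y⟩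
    fin_cases i <;> fin_cases i'
    · refine Eq.trans ?_ (hform 0 0 1 0 (fun t => by simp [u]) x y).symm
      by_cases h : x = y
      · simp [twoRowBlock, hg0, h]
      · simp [twoRowBlock, hg0, h, Ne.symm h]
    · refine Eq.trans ?_
        (hform 0 1 (-1) 1 (fun t => by simp [u, -RCLike.star_def, star_stdAddChar]) x y).symm
      by_cases h : g 1 x = y
      · simp [twoRowBlock, h, (hgneg 1 x y).1 h]
      · simp [twoRowBlock, h, mt (hgneg 1 x y).2 h]
    · refine Eq.trans ?_ (hform 1 0 (-1) (-1) (fun t => by simp [u]) x y).symm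
      simp only [twoRowBlock, Matrix.of_apply, neg_neg]
      by_cases h : g 1 y = x
      · have := hf 1 y
        rw [h] at this
        simp [h, this]
      · simp [h]
    · refine Eq.trans ?_ (hform 1 1 1 0 (fun t => by simpa [u] using huu t) x y).symm
      by_cases h : x = y
      · simp [twoRowBlock, hg0, h]
      · simp [twoRowBlock, hg0, h, Ne.symm h]
  rw [hdecomp]
  refine smul_mem_separableCone (sum_mem fun t _ => sum_mem fun j _ => ?_) (by positivity)
  exact smul_mem_separableCone (kronecker_mem_separableCone
    (Matrix.posSemidef_vecMulVec_self_star _) (Matrix.posSemidef_vecMulVec_self_star _)) (hf0 j)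

end Orbit

/-- The powers of `σ` form an action of `ZMod (orderOf σ)`, and the indicator of non-fixed points is
invariant under it. -/
lemma twoRowBlock_perm_mem_separableCone {n : Type*} [Fintype n] [DecidableEq n]
    (σ : Equiv.Perm n) :
    twoRowBlock (fun x => if σ x = x then 0 else 1)
      (Matrix.of fun x y => if σ x = x then 0 else if σ x = y then 1 else 0) ∈
      separableCone (Fin 2) n := by
  have : NeZero (orderOf σ) := ⟨(orderOf_pos σ).ne'⟩
  have h1 : σ ^ (1 : ZMod (orderOf σ)).val = σ := by
    rw [ZMod.val_one_eq_one_mod, pow_mod_orderOf, pow_one]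
  have hfix : ∀ (s : ℕ) x, σ ((σ ^ s) x) = (σ ^ s) x ↔ σ x = x := by
    intro s x
    rw [← Equiv.Perm.mul_apply, ← pow_succ', pow_succ, Equiv.Perm.mul_apply,
      (σ ^ s).injective.eq_iff]
  have h := twoRowBlock_action_mem_separableCone (k := orderOf σ) (fun s => σ ^ s.val)
    (fun s s' => by rw [ZMod.val_add, pow_mod_orderOf, pow_add])
    (fun x => if σ x = x then 0 else 1) (fun x => by split_ifs <;> norm_num)
    (fun s x => by simp only [hfix])
  convert h using 3
  rw [h1]
  funext x y
  split_ifs <;> rfl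

/-- `[[D, -N], [-Nᵀ, D]]` is separable when `N` is nonnegative, has zero diagonal, and has both
row sums and column sums given by `D`. -/
lemma twoRowBlock_mem_separableCone {n : Type*} [Fintype n] [DecidableEq n] {d : n → ℝ}
    {N : Matrix n n ℝ} (hN : ∀ x y, 0 ≤ N x y) (hdiag : ∀ x, N x x = 0)
    (hrow : ∀ x, ∑ y, N x y = d x) (hcol : ∀ y, ∑ x, N x y = d y) :
    twoRowBlock d N ∈ separableCone (Fin 2) n := by
  have hd : ∀ x, 0 ≤ d x := fun x => hrow x ▸ Finset.sum_nonneg fun y _ => hN x y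
  -- Any positive bound for all `d x` would do: padding the diagonal of `N` by `m - d x` makes all
  -- row and column sums equal to `m`.
  set m : ℝ := 1 + ∑ x, d x with hm
  have hdm : ∀ x, d x ≤ m := fun x => by
    have := Finset.single_le_sum (fun i _ => hd i) (Finset.mem_univ x)
    linarith
  have hm0 : 0 < m := by
    have := Finset.sum_nonneg fun i (_ : i ∈ Finset.univ) => hd i
    linarith
  have hmem : (Matrix.of fun x y => m⁻¹ * (N x y + if x = y then m - d x else 0)) ∈
      doublyStochastic ℝ n := by
    rw [mem_doublyStochastic_iff_sum]
    refine ⟨fun x y => ?_, fun x => ?_, fun y => ?_⟩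
    · have h1 := hN x y
      have h2 := hdm x
      rw [Matrix.of_apply]
      refine mul_nonneg (by positivity) ?_
      split_ifs <;> linarith
    · simp only [Matrix.of_apply, ← Finset.mul_sum, Finset.sum_add_distrib, hrow]
      simp [hm0.ne']
    · simp only [Matrix.of_apply, ← Finset.mul_sum, Finset.sum_add_distrib, hcol]
      simp [hm0.ne']
  obtain ⟨w, hw0, hw1, hw⟩ := exists_eq_sum_perm_of_mem_doublyStochastic hmem
  have hentry : ∀ x y, ∑ σ : Equiv.Perm n, w σ * (if σ x = y then 1 else 0) =
      m⁻¹ * (N x y + if x = y then m - d x else 0) := by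
    intro x y
    have := congrFun (congrFun hw x) y
    simpa [Matrix.sum_apply, PEquiv.toMatrix_apply, eq_comm] using this
  have hdecomp : twoRowBlock d N = ∑ σ : Equiv.Perm n, ((m * w σ : ℝ) : ℂ) •
      twoRowBlock (fun x => if σ x = x then 0 else 1)
        (Matrix.of fun x y => if σ x = x then 0 else if σ x = y then 1 else 0) := by
    have hN' : ∀ x y, N x y = ∑ σ : Equiv.Perm n, m * w σ *
        (if σ x = x then 0 else if σ x = y then 1 else 0) := by
      intro x y
      by_cases h : x = y
      · subst h
        rw [hdiag, Finset.sum_eq_zero]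
        intro σ _
        split_ifs <;> simp
      · calc N x y = m * ∑ σ : Equiv.Perm n, w σ * (if σ x = y then 1 else 0) := by
              rw [hentry, if_neg h, add_zero, mul_inv_cancel_left₀ hm0.ne']
          _ = _ := by
              rw [Finset.mul_sum]
              refine Finset.sum_congr rfl fun σ _ => ?_
              by_cases h1 : σ x = x
              · simp [h1, h]
              · simp [h1]
    -- Permutations fixing `x` carry total weight `m - d x`, exactly the padding; discarding fixed
    -- points leaves `d x`.
    have hd' : ∀ x, d x = ∑ σ : Equiv.Perm n, m * w σ * (if σ x = x then 0 else 1) := by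
      intro x
      have h1 : ∀ σ : Equiv.Perm n, m * w σ * (if σ x = x then 0 else 1) =
          m * w σ - m * (w σ * if σ x = x then 1 else 0) := by
        intro σ; split_ifs <;> ring
      simp only [h1, Finset.sum_sub_distrib, ← Finset.mul_sum]
      rw [hentry, hw1, hdiag, if_pos rfl, mul_inv_cancel_left₀ hm0.ne']
      ring
    ext ⟨i, x⟩ ⟨j, y⟩
    simp only [Matrix.sum_apply, Matrix.smul_apply, smul_eq_mul, twoRowBlock, Matrix.of_apply]
    by_cases hij : i = j
    · by_cases hxy : x = y
      · simp only [hij, hxy, if_true]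
        rw [hd' y]
        push_cast
        rfl
      · simp [hij, hxy]
    · by_cases hi : i = 0
      · simp only [hi, if_true]
        rw [← hi, if_neg hij, hN' x y]
        simp only [if_neg hij, mul_neg, Finset.sum_neg_distrib]
        push_cast
        rfl
      · simp only [hij, hi, if_false]
        rw [hN' y x]
        simp only [mul_neg, Finset.sum_neg_distrib]
        push_cast
        rfl
  rw [hdecomp]
  exact sum_mem fun σ _ => smul_mem_separableCone (twoRowBlock_perm_mem_separableCone σ)
    (mul_nonneg hm0.le (hw0 σ))

/-! ### Degree conditions counted row by row -/

namespace GridLabelledGraph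
variable {V : Type*} {a b : ℕ}

open scoped Classical in
/-- The number of neighbours of `p` in row `i`. -/
noncomputable def rowDegree (G : GridLabelledGraph V a b) (p : Fin a × Fin b) (i : Fin a) : ℕ :=
  ∑ l, if G.gridGraph.Adj p (i, l) then 1 else 0

lemma degree_eq_sum_rowDegree (G : GridLabelledGraph V a b) (p : Fin a × Fin b) :
    G.degree p = ∑ i, G.rowDegree p i := by
  classical
  have := G.gridGraph.degree_eq_sum_if_adj (R := ℕ) p
  rw [Fintype.sum_prod_type] at this
  rw [Nat.cast_id] at this
  simp only [degree, rowDegree]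
  convert this

lemma gridGraph_partialTranspose_adj (G : GridLabelledGraph V a b) (p q : Fin a × Fin b) :
    G.partialTranspose.gridGraph.Adj p q ↔ G.gridGraph.Adj (q.1, p.2) (p.1, q.2) := by
  simp only [gridGraph, partialTranspose, SimpleGraph.comap_adj, Equiv.apply_symm_apply]
  constructor
  · rintro ⟨x, y, h, rfl, rfl⟩
    simpa using h
  · intro h
    exact ⟨_, _, h, by simp, by simp⟩

lemma gridGraph_diagonalPart_adj (G : GridLabelledGraph V a b) (p q : Fin a × Fin b) :
    G.diagonalPart.gridGraph.Adj p q ↔ G.gridGraph.Adj p q ∧ p.1 ≠ q.1 ∧ p.2 ≠ q.2 := by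
  simp [gridGraph, diagonalPart]

lemma rowDegree_partialTranspose (G : GridLabelledGraph V a b) (i k : Fin a) (j : Fin b) :
    G.partialTranspose.rowDegree (i, j) k = G.rowDegree (k, j) i := by
  classical
  exact Finset.sum_congr rfl fun l _ =>
    if_congr (G.gridGraph_partialTranspose_adj (i, j) (k, l)) rfl rfl

lemma rowDegree_diagonalPart_self (G : GridLabelledGraph V a b) (i : Fin a) (j : Fin b) :
    G.diagonalPart.rowDegree (i, j) i = 0 := by
  simp [rowDegree, gridGraph_diagonalPart_adj]

open scoped Classical in
lemma rowDegree_eq_diagonalPart_add (G : GridLabelledGraph V a b) {i k : Fin a} (hik : i ≠ k)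
    (j : Fin b) : G.rowDegree (i, j) k =
      G.diagonalPart.rowDegree (i, j) k + if G.gridGraph.Adj (i, j) (k, j) then 1 else 0 := by
  have h : (if G.gridGraph.Adj (i, j) (k, j) then 1 else 0) =
      ∑ l, if l = j then (if G.gridGraph.Adj (i, j) (k, j) then 1 else 0) else 0 := by
    rw [Finset.sum_ite_eq' Finset.univ j, if_pos (Finset.mem_univ j)]
  rw [h]
  simp only [rowDegree, gridGraph_diagonalPart_adj, ← Finset.sum_add_distrib]
  refine Finset.sum_congr rfl fun l _ => ?_
  by_cases hl : l = j
  · subst hl; simp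
  · simp [hl, hik, Ne.symm hl]

lemma degreeCriterion_iff_degree (G : GridLabelledGraph V a b) :
    G.DegreeCriterion ↔ ∀ p, G.degree p = G.partialTranspose.degree p := by
  simp only [DegreeCriterion, degreeMatrix, degree, SimpleGraph.degMatrix,
    Matrix.diagonal_eq_diagonal_iff, Nat.cast_inj]

lemma rowDegree_self_eq_zero (G : GridLabelledGraph V a b) (h : ¬ G.HasHorizontalEdge)
    (i : Fin a) (j : Fin b) : G.rowDegree (i, j) i = 0 := by
  refine Finset.sum_eq_zero fun l _ => if_neg fun hadj => h ?_
  exact ⟨_, _, hadj, by simp⟩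

section TwoRows
variable (G : GridLabelledGraph V 2 b)

/-- Partial transposition keeps the within-row counts and exchanges the two cross-row counts of a
column. -/
lemma degreeCriterion_iff_rowDegree :
    G.DegreeCriterion ↔ ∀ j, G.rowDegree (0, j) 1 = G.rowDegree (1, j) 0 := by
  rw [degreeCriterion_iff_degree]
  simp only [degree_eq_sum_rowDegree, Fin.sum_univ_two, Prod.forall, Fin.forall_fin_two,
    rowDegree_partialTranspose]
  constructor
  · exact fun h j => by have := h.1 j; omega
  · exact fun h => ⟨fun j => by have := h j; omega, fun j => by have := h j; omega⟩

/-- A vertical edge in column `j` adds one to both cross-row counts, so it cancels. -/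
lemma degree_diagonalPart_eq_iff_rowDegree (j : Fin b) :
    G.diagonalPart.degree (0, j) = G.diagonalPart.degree (1, j) ↔
      G.rowDegree (0, j) 1 = G.rowDegree (1, j) 0 := by
  rw [degree_eq_sum_rowDegree, degree_eq_sum_rowDegree, Fin.sum_univ_two, Fin.sum_univ_two,
    rowDegree_diagonalPart_self, rowDegree_diagonalPart_self,
    G.rowDegree_eq_diagonalPart_add zero_ne_one, G.rowDegree_eq_diagonalPart_add one_ne_zero,
    G.gridGraph.adj_comm (1, j)]
  omega

lemma degree_eq_iff_rowDegree_of_not_hasHorizontalEdge (h : ¬ G.HasHorizontalEdge) (j : Fin b) :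
    G.degree (0, j) = G.degree (1, j) ↔ G.rowDegree (0, j) 1 = G.rowDegree (1, j) 0 := by
  rw [degree_eq_sum_rowDegree, degree_eq_sum_rowDegree, Fin.sum_univ_two, Fin.sum_univ_two,
    G.rowDegree_self_eq_zero h, G.rowDegree_self_eq_zero h]
  omega

end TwoRows

/-! ### The Laplacian and necessity of the degree criterion -/

open scoped Classical in
lemma laplacian_apply (G : GridLabelledGraph V a b) (p q : Fin a × Fin b) :
    G.laplacian p q = (if p = q then (G.degree p : ℂ) else 0) -
      if G.gridGraph.Adj p q then 1 else 0 := by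
  simp [laplacian, SimpleGraph.lapMatrix, SimpleGraph.degMatrix, degree, Matrix.diagonal_apply]

lemma trace_laplacian (G : GridLabelledGraph V a b) :
    G.laplacian.trace = 2 * (G.numEdges : ℂ) := by
  classical
  let e : G.gridGraph ≃g G.graph := ⟨G.label.symm, by simp [gridGraph]⟩
  have : Fintype V := Fintype.ofEquiv _ G.label.symm
  have h : G.numEdges = G.gridGraph.edgeFinset.card := by
    rw [e.card_edgeFinset_eq, numEdges, Set.ncard_eq_toFinset_card']
    rfl
  have h2 := G.gridGraph.sum_degrees_eq_twice_card_edges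
  rw [h, Matrix.trace]
  simp only [Matrix.diag_apply, laplacian_apply, if_true, SimpleGraph.irrefl, if_false, sub_zero]
  rw [← Nat.cast_sum]
  exact_mod_cast h2

lemma numEdges_ne_zero {G : GridLabelledGraph V a b} (hG : G.graph.edgeSet.Nonempty) :
    G.numEdges ≠ 0 := by
  have : Finite V := Finite.of_equiv _ G.label.symm
  exact ((Set.ncard_pos (Set.toFinite _)).2 hG).ne'

lemma isSeparable_of_laplacian_mem_separableCone {G : GridLabelledGraph V a b}
    (hG : G.graph.edgeSet.Nonempty) (h : G.laplacian ∈ separableCone (Fin a) (Fin b)) :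
    G.IsSeparable := by
  refine isSeparableMatrix_of_mem_separableCone ?_ ?_
  · have := smul_mem_separableCone h (c := 1 / (2 * (G.numEdges : ℝ))) (by positivity)
    rw [densityMatrix]
    convert this
    push_cast
    rfl
  · have : (G.numEdges : ℂ) ≠ 0 := Nat.cast_ne_zero.2 (numEdges_ne_zero hG)
    rw [densityMatrix, Matrix.trace_smul, trace_laplacian, smul_eq_mul]
    field_simp

-- Partial transposition fixes the degree matrix and turns `A(G)` into `A(Γ(G))`.
open scoped Classical in
lemma sum_laplacian_partialTranspose (G : GridLabelledGraph V a b) (p : Fin a × Fin b) :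
    ∑ q : Fin a × Fin b, G.laplacian (q.1, p.2) (p.1, q.2) =
      (G.degree p : ℂ) - G.partialTranspose.degree p := by
  simp only [laplacian_apply, Finset.sum_sub_distrib]
  congr 1
  · rw [Finset.sum_eq_single p]
    · simp
    · rintro q _ hq
      refine if_neg fun h => hq ?_
      simp only [Prod.mk.injEq] at h
      exact Prod.ext h.1 h.2.symm
    · simp
  · have := G.partialTranspose.gridGraph.degree_eq_sum_if_adj (R := ℂ) p
    simp only [gridGraph_partialTranspose_adj] at this
    exact this.symm

lemma sum_laplacian (G : GridLabelledGraph V a b) : ∑ p, ∑ q, G.laplacian p q = 0 := by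
  classical
  refine Finset.sum_eq_zero fun p _ => ?_
  have := congrFun (G.gridGraph.lapMatrix_mulVec_const_eq_zero (R := ℂ)) p
  simpa [Matrix.mulVec, dotProduct, laplacian] using this

/-- The degree criterion is necessary for separability. -/
lemma IsSeparable.degreeCriterion {G : GridLabelledGraph V a b}
    (hG : G.graph.edgeSet.Nonempty) (h : G.IsSeparable) : G.DegreeCriterion := by
  have hP := IsSeparableMatrix.posSemidef_partialTranspose h
  set P := Matrix.of fun p q : Fin a × Fin b => G.densityMatrix (q.1, p.2) (p.1, q.2) with hPdef
  have hm : (1 / (2 * (G.numEdges : ℂ))) ≠ 0 := by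
    have : (G.numEdges : ℂ) ≠ 0 := Nat.cast_ne_zero.2 (numEdges_ne_zero hG)
    positivity
  have hrow : ∀ p, (P.mulVec 1) p = (1 / (2 * (G.numEdges : ℂ))) *
      ∑ q : Fin a × Fin b, G.laplacian (q.1, p.2) (p.1, q.2) := by
    intro p
    simp [P, Matrix.mulVec, dotProduct, densityMatrix, Finset.mul_sum]
  -- Partial transposition only permutes matrix entries, so their total is unchanged.
  have hsum : star 1 ⬝ᵥ P.mulVec 1 = 0 := by
    simp only [dotProduct, hrow, star_one, Pi.one_apply, one_mul, ← Finset.mul_sum]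
    have hswap : ∑ p : Fin a × Fin b, ∑ q : Fin a × Fin b, G.laplacian (q.1, p.2) (p.1, q.2) =
        ∑ p, ∑ q, G.laplacian p q := by
      simp only [Fintype.sum_prod_type]
      rw [Finset.sum_comm]
      conv_rhs => rw [Finset.sum_comm]
      refine Finset.sum_congr rfl fun j _ => ?_
      rw [Finset.sum_comm]
    rw [hswap, sum_laplacian, mul_zero]
  -- A positive semidefinite form vanishing at a vector has that vector in its kernel.
  have hzero := (hP.dotProduct_mulVec_zero_iff 1).1 hsum
  rw [degreeCriterion_iff_degree]
  intro p
  have := congrFun hzero p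
  rw [hrow, sum_laplacian_partialTranspose, Pi.zero_apply, mul_eq_zero, or_iff_right hm,
    sub_eq_zero] at this
  exact_mod_cast this

/-! ### Sufficiency for two rows -/

section TwoRows
variable {G : GridLabelledGraph V 2 b}

open scoped Classical in
/-- The Laplacian of a two-row graph is the sum of the contributions of its horizontal, vertical
and diagonal edges. -/
lemma laplacian_eq_sum_of_rowDegree_eq
    (h : ∀ j, G.rowDegree (0, j) 1 = G.rowDegree (1, j) 0) :
    G.laplacian =
      (∑ i, Matrix.single i i (1 : ℂ) ⊗ₖ
        ((G.gridGraph.comap fun j => (i, j)).lapMatrix ℝ).map Complex.ofReal) +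
      Matrix.vecMulVec ![1, -1] (star ![1, -1]) ⊗ₖ
        Matrix.diagonal (fun j => if G.gridGraph.Adj (0, j) (1, j) then (1 : ℂ) else 0) +
      twoRowBlock (fun j => (G.diagonalPart.rowDegree (0, j) 1 : ℝ))
        (Matrix.of fun j l => if G.diagonalPart.gridGraph.Adj (0, j) (1, l) then 1 else 0) := by
  have hrow : ∀ i j, (((G.gridGraph.comap fun j => (i, j)).degree j : ℕ) : ℝ) =
      G.rowDegree (i, j) i := by
    intro i j
    rw [SimpleGraph.degree_eq_sum_if_adj, rowDegree]
    simp
  have hdeg0 : ∀ j, G.degree (0, j) = G.rowDegree (0, j) 0 +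
      (G.diagonalPart.rowDegree (0, j) 1 + if G.gridGraph.Adj (0, j) (1, j) then 1 else 0) := by
    intro j
    rw [degree_eq_sum_rowDegree, Fin.sum_univ_two, G.rowDegree_eq_diagonalPart_add zero_ne_one]
  -- By `h`, the count for row 0 also serves row 1, as the block matrix has the same `D` in both
  -- diagonal blocks.
  have hdeg1 : ∀ j, G.degree (1, j) = G.rowDegree (1, j) 1 +
      (G.diagonalPart.rowDegree (0, j) 1 + if G.gridGraph.Adj (0, j) (1, j) then 1 else 0) := by
    intro j
    rw [degree_eq_sum_rowDegree, Fin.sum_univ_two, ← h,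
      G.rowDegree_eq_diagonalPart_add zero_ne_one,
      add_comm]
  ext ⟨i, x⟩ ⟨k, y⟩
  rw [laplacian_apply]
  fin_cases i <;> fin_cases k <;>
    simp [-Matrix.cons_vecMulVec, Matrix.add_apply, Fin.sum_univ_two, twoRowBlock,
      SimpleGraph.lapMatrix,
      SimpleGraph.degMatrix, Matrix.diagonal_apply, Matrix.vecMulVec_apply,
      gridGraph_diagonalPart_adj, hrow]
  · by_cases hxy : x = y
    · simp only [hxy, if_true, hdeg0]
      push_cast
      simp
      ring
    · by_cases hadj : G.gridGraph.Adj (0, x) (0, y) <;> simp [hxy, hadj]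
  · by_cases hadj : G.gridGraph.Adj (0, x) (1, y) <;> by_cases hxy : x = y
    · subst hxy; simp [hadj]
    · simp [hxy, hadj]
    · subst hxy; simp [hadj]
    · simp [hxy, hadj]
  · have hsymm := G.gridGraph.adj_comm (1, x) (0, y)
    by_cases hadj : G.gridGraph.Adj (0, y) (1, x) <;> by_cases hxy : x = y
    · subst hxy; simp [hadj, hadj.symm]
    · simp [hxy, Ne.symm hxy, hadj, hadj.symm]
    · subst hxy; simp [hadj, mt hsymm.1 hadj]
    · simp [hxy, hadj, mt hsymm.1 hadj]
  · by_cases hxy : x = y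
    · simp only [hxy, if_true, hdeg1]
      push_cast
      simp
      ring
    · by_cases hadj : G.gridGraph.Adj (1, x) (1, y) <;> simp [hxy, hadj]

/-- The degree criterion is sufficient for separability of two-row graphs. -/
lemma isSeparable_of_rowDegree_eq (hG : G.graph.edgeSet.Nonempty)
    (h : ∀ j, G.rowDegree (0, j) 1 = G.rowDegree (1, j) 0) : G.IsSeparable := by
  classical
  refine isSeparable_of_laplacian_mem_separableCone hG ?_
  rw [laplacian_eq_sum_of_rowDegree_eq h]
  refine add_mem (add_mem (sum_mem fun i _ => ?_) ?_) ?_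
  · refine kronecker_mem_separableCone ?_ (SimpleGraph.posSemidef_lapMatrix ℝ _).map_ofReal
    rw [← Matrix.diagonal_single]
    exact Matrix.PosSemidef.diagonal (Pi.single_nonneg.2 zero_le_one)
  · refine kronecker_mem_separableCone (Matrix.posSemidef_vecMulVec_self_star _)
      (Matrix.PosSemidef.diagonal fun j => ?_)
    dsimp only
    split_ifs <;> simp
  · refine twoRowBlock_mem_separableCone (fun x y => ?_) (fun x => ?_) (fun x => ?_) (fun y => ?_)
    · rw [Matrix.of_apply]
      split_ifs <;> simp
    · simp [gridGraph_diagonalPart_adj]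
    · simp [rowDegree]
    · have h1 := (G.degree_diagonalPart_eq_iff_rowDegree y).2 (h y)
      simp only [degree_eq_sum_rowDegree, Fin.sum_univ_two, rowDegree_diagonalPart_self,
        zero_add, add_zero] at h1
      rw [h1]
      simp [rowDegree, G.diagonalPart.gridGraph.adj_comm (1, y)]

end TwoRows

end GridLabelledGraph

theorem mainTheorem1 {V : Type*} {b : ℕ} (hb : 1 ≤ b) (G : GridLabelledGraph V 2 b)
    (hG : G.graph.edgeSet.Nonempty) :
    (G.DegreeCriterion ↔ G.IsSeparable) ∧
    (G.IsSeparable ↔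
      ∀ j : Fin b, G.diagonalPart.degree (0, j) = G.diagonalPart.degree (1, j)) ∧
    (¬ G.HasHorizontalEdge →
      (G.IsSeparable ↔ ∀ j : Fin b, G.degree (0, j) = G.degree (1, j))) := by
  have key : G.IsSeparable ↔ ∀ j, G.rowDegree (0, j) 1 = G.rowDegree (1, j) 0 :=
    ⟨fun h => G.degreeCriterion_iff_rowDegree.1 (h.degreeCriterion hG),
      GridLabelledGraph.isSeparable_of_rowDegree_eq hG⟩
  refine ⟨G.degreeCriterion_iff_rowDegree.trans key.symm, ?_, fun h => ?_⟩
  · simp only [key, G.degree_diagonalPart_eq_iff_rowDegree]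
  · simp only [key, G.degree_eq_iff_rowDegree_of_not_hasHorizontalEdge h]
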